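/- Let $\Theta=\mathbb R^d$ with Lebesgue measure, let $\mathcal F$ be a real Hilbert space, let $R:\mathcal F\to[0,\infty)$ be convex and Fréchet differentiable, and let $\Psi:\Theta\to\mathcal F$ be such that $\langle\Psi,\rho\rangle:=\int_\Theta\rho(\theta)\Psi(\theta)\,d\theta$ is a convergent Bochner integral for every $\rho\in L^1(\Theta)$. Let $g:\Theta\to[0,\infty)$, and put $$F_0(\rho)=R(\langle\Psi,\rho\rangle),\qquad F(\rho)=F_0(\rho)+\int_\Theta g\,\rho,$$ with differentials, as functions of $\theta\in\Theta$, $$F_0'(\rho)(\theta)=R'(\langle\Psi,\rho\rangle)\,[\Psi(\theta)],\qquad F'(\rho)(\theta)=F_0'(\rho)(\theta)+g(\theta)\qquad(\rho\in L^1(\Theta)).$$ Assume that * the family of functions $\{F_0'(\rho):\rho\in L^1(\Theta),\ \|\rho\|_1\le 1\}$ on $\Theta$ is uniformly equicontinuous and uniformly bounded; * $g$ is differentiable and confining, i.e. $g(\theta)\to\infty$ as $|\theta|\to\infty$ and $\exp(-bg)$ is integrable for every $b>0$. Let $\beta>0$ and let $\mathcal P(\Theta)=\{\rho\in L^1(\Theta):\rho\ge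 0 \text{ a.e.},\ \int_\Theta\rho=1\}$ be the set of probability densities on $\Theta$ (identified when equal a.e.). Then for every $\rho\in\mathcal P(\Theta)$ the function $\exp(-\beta F'(\rho))$ is integrable with $Z_2(\rho):=\int_\Theta\exp(-\beta F'(\rho)(\theta))\,d\theta>0$, so that $$T:\mathcal P(\Theta)\to\mathcal P(\Theta),\qquad T(\rho)(\theta)=\frac{\exp(-\beta F'(\rho)(\theta))}{Z_2(\rho)},$$ is well defined, and $T$ has exactly one fixed point. -/

import Mathlib

open MeasureTheory Filter Topology

namespace MeanField

noncomputable section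

/-- The parameter space `ℝ^d` with its Euclidean norm (and Lebesgue measure `volume`). -/
abbrev Param (d : ℕ) : Type := EuclideanSpace ℝ (Fin d)

/-- The space `L¹` of (classes of) Lebesgue integrable functions on the parameter space. -/
abbrev L1 (d : ℕ) : Type := Lp ℝ 1 (volume : Measure (Param d))

/-- The set of probability density functions, as a subset of `L¹`. -/
def densities (d : ℕ) : Set (L1 d) :=
  {ρ | (∀ᵐ θ ∂(volume : Measure (Param d)), 0 ≤ ρ θ) ∧ ∫ θ, ρ θ = 1}

/-- `g` is confining: it tends to infinity at infinity and `exp (-β g)` is integrable for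
every `β > 0`. -/
def IsConfining {d : ℕ} (g : Param d → ℝ) : Prop :=
  Tendsto g (comap (fun θ => ‖θ‖) atTop) atTop ∧
    ∀ β : ℝ, 0 < β → Integrable (fun θ => Real.exp (-β * g θ))

section Functionals

variable {d : ℕ} {E : Type*} [NormedAddCommGroup E] [InnerProductSpace ℝ E]

/-- The pairing `⟨Ψ, ρ⟩ = ∫ Ψ(θ) ρ(θ) dθ`, an element of the feature space. -/
def pairing (Ψ : Param d → E) (ρ : L1 d) : E := ∫ θ, ρ θ • Ψ θ

/-- The unregularized risk `F₀(ρ) = R(⟨Ψ, ρ⟩)`. -/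
def risk (R : E → ℝ) (Ψ : Param d → E) (ρ : L1 d) : ℝ := R (pairing Ψ ρ)

/-- The regularized risk `F(ρ) = F₀(ρ) + ⟨g, ρ⟩`. -/
def regRisk (R : E → ℝ) (Ψ : Param d → E) (g : Param d → ℝ) (ρ : L1 d) : ℝ :=
  risk R Ψ ρ + ∫ θ, g θ * ρ θ

/-- The differential `F₀'(ρ)`, as the function `θ ↦ ⟨R'(⟨Ψ, ρ⟩), Ψ(θ)⟩` of the parameter.
`hasFDerivAt_risk` shows that it represents the Fréchet differential of `risk` on `L¹`. -/
def riskDeriv (R : E → ℝ) (Ψ : Param d → E) (ρ : L1 d) (θ : Param d) : ℝ :=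
  fderiv ℝ R (pairing Ψ ρ) (Ψ θ)

/-- The differential `F'(ρ) = F₀'(ρ) + g`, as a function of the parameter.
See `hasDerivAt_regRisk`. -/
def regRiskDeriv (R : E → ℝ) (Ψ : Param d → E) (g : Param d → ℝ) (ρ : L1 d)
    (θ : Param d) : ℝ :=
  riskDeriv R Ψ ρ θ + g θ

/-- The unnormalized Boltzmann weight `exp (-β F'(ρ)(θ))`. -/
def boltzmannWeight (R : E → ℝ) (Ψ : Param d → E) (g : Param d → ℝ) (β : ℝ) (ρ : L1 d)
    (θ : Param d) : ℝ :=
  Real.exp (-β * regRiskDeriv R Ψ g ρ θ)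

/-- The normalizing constant `Z₂(ρ) = ∫ exp (-β F'(ρ)(θ)) dθ`. -/
def partitionFn (R : E → ℝ) (Ψ : Param d → E) (g : Param d → ℝ) (β : ℝ) (ρ : L1 d) : ℝ :=
  ∫ θ, boltzmannWeight R Ψ g β ρ θ

/-- The pairing `⟨Ψ, ρ⟩` is a Bochner integral that converges for every `ρ ∈ L¹`, so that
`F₀` and `F₀'` are defined on all of `L¹`. -/
def PairingDefined (Ψ : Param d → E) : Prop :=
  ∀ ρ : L1 d, Integrable (fun θ => ρ θ • Ψ θ)

/-! ### The functions above represent the differentials of the functionals -/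

theorem pairing_add_smul {Ψ : Param d → E} (hΨ : PairingDefined Ψ) (c : ℝ) (ρ h : L1 d) :
    pairing Ψ (ρ + c • h) = pairing Ψ ρ + c • pairing Ψ h := by
  unfold pairing
  have hc : Integrable (fun θ => c • h θ • Ψ θ) := (hΨ h).smul c
  rw [← integral_smul, ← integral_add (hΨ ρ) hc]
  apply integral_congr_ae
  filter_upwards [Lp.coeFn_add ρ (c • h), Lp.coeFn_smul c h] with θ h1 h2
  rw [h1, Pi.add_apply, h2, Pi.smul_apply, add_smul, smul_eq_mul, mul_smul]

/-- The pairing as a linear map on `L¹`. -/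
def pairingLin {Ψ : Param d → E} (hΨ : PairingDefined Ψ) : L1 d →ₗ[ℝ] E where
  toFun := pairing Ψ
  map_add' ρ h := by simpa using pairing_add_smul hΨ 1 ρ h
  map_smul' c h := by
    have h0 : pairing Ψ (0 : L1 d) = 0 := by
      have := pairing_add_smul hΨ 1 (0 : L1 d) 0
      simpa using this
    simpa [h0] using pairing_add_smul hΨ c 0 h

theorem pairingLin_apply {Ψ : Param d → E} (hΨ : PairingDefined Ψ) (ρ : L1 d) :
    pairingLin hΨ ρ = pairing Ψ ρ := rfl

/-- By the closed graph theorem, a pairing that is defined on all of `L¹` is continuous. -/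
theorem continuous_pairing [CompleteSpace E] {Ψ : Param d → E} (hΨ : PairingDefined Ψ) :
    Continuous (pairing Ψ : L1 d → E) := by
  let Φ : L1 d →ₗ[ℝ] (Lp E 1 (volume : Measure (Param d))) :=
    { toFun := fun ρ => (hΨ ρ).toL1 _
      map_add' := fun ρ h => by
        rw [← Integrable.toL1_add, Integrable.toL1_eq_toL1_iff]
        filter_upwards [Lp.coeFn_add ρ h] with θ h1
        change (ρ + h : L1 d) θ • Ψ θ = ρ θ • Ψ θ + h θ • Ψ θ
        rw [h1, Pi.add_apply, add_smul]
      map_smul' := fun c h => by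
        rw [RingHom.id_apply, ← Integrable.toL1_smul, Integrable.toL1_eq_toL1_iff]
        filter_upwards [Lp.coeFn_smul c h] with θ h1
        simp [h1, mul_smul] }
  have hΦ : ∀ ρ : L1 d, (Φ ρ : Param d → E) =ᵐ[volume] fun θ => ρ θ • Ψ θ :=
    fun ρ => Integrable.coeFn_toL1 (hΨ ρ)
  have hc : Continuous Φ := by
    refine Φ.continuous_of_seq_closed_graph fun u ρ k hu hk => ?_
    obtain ⟨ns, hns, hae⟩ := (tendstoInMeasure_of_tendsto_Lp hu).exists_seq_tendsto_ae
    have hk' : Tendsto (fun n => Φ (u (ns n))) atTop (𝓝 k) := hk.comp hns.tendsto_atTop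
    obtain ⟨ms, hms, hae'⟩ := (tendstoInMeasure_of_tendsto_Lp hk').exists_seq_tendsto_ae
    apply Lp.ext
    have hall : ∀ᵐ θ ∂(volume : Measure (Param d)), ∀ n, Φ (u n) θ = u n θ • Ψ θ :=
      ae_all_iff.2 fun n => hΦ (u n)
    filter_upwards [hae, hae', hall, hΦ ρ] with θ h1 h2 h3 h4
    rw [h4]
    refine tendsto_nhds_unique h2 ?_
    simp only [h3]
    exact (h1.comp hms.tendsto_atTop).smul_const _
  have : (pairing Ψ : L1 d → E) = fun ρ => ∫ θ, Φ ρ θ := by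
    funext ρ
    exact integral_congr_ae (hΦ ρ).symm
  rw [this]
  exact continuous_integral.comp hc

/-- Chain rule: `F₀` is Fréchet differentiable on `L¹` and its differential at `ρ` is the
integration against `riskDeriv R Ψ ρ`. -/
theorem hasFDerivAt_risk [CompleteSpace E] {R : E → ℝ} {Ψ : Param d → E}
    (hR : Differentiable ℝ R) (hΨ : PairingDefined Ψ) (ρ : L1 d) :
    ∃ D : L1 d →L[ℝ] ℝ, HasFDerivAt (risk R Ψ) D ρ ∧
      ∀ h : L1 d, D h = ∫ θ, riskDeriv R Ψ ρ θ * h θ := by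
  let L : L1 d →L[ℝ] E := ⟨pairingLin hΨ, continuous_pairing hΨ⟩
  refine ⟨(fderiv ℝ R (pairing Ψ ρ)).comp L, ?_, fun h => ?_⟩
  · exact HasFDerivAt.comp (g := R) (f := L) ρ (hR _).hasFDerivAt L.hasFDerivAt
  · change fderiv ℝ R (pairing Ψ ρ) (∫ θ, h θ • Ψ θ) = _
    rw [← ContinuousLinearMap.integral_comp_comm _ (hΨ h)]
    simp [riskDeriv, mul_comm]

/-- The function `regRiskDeriv R Ψ g ρ` represents the directional derivatives of `F` at `ρ`,
in the directions in which the linear term `⟨g, ·⟩` is finite. -/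
theorem hasDerivAt_regRisk [CompleteSpace E] {R : E → ℝ} {Ψ : Param d → E} {g : Param d → ℝ}
    (hR : Differentiable ℝ R) (hΨ : PairingDefined Ψ) (ρ h : L1 d)
    (hρ : Integrable (fun θ => g θ * ρ θ)) (hh : Integrable (fun θ => g θ * h θ)) :
    HasDerivAt (fun t : ℝ => regRisk R Ψ g (ρ + t • h))
      (∫ θ, regRiskDeriv R Ψ g ρ θ * h θ) 0 := by
  obtain ⟨D, hD, hDh⟩ := hasFDerivAt_risk hR hΨ ρ
  have hint : Integrable (fun θ => riskDeriv R Ψ ρ θ * h θ) := by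
    have := (fderiv ℝ R (pairing Ψ ρ)).integrable_comp (hΨ h)
    simpa [riskDeriv, mul_comm] using this
  have hline : HasDerivAt (fun t : ℝ => ρ + t • h) h 0 := by
    simpa using ((hasDerivAt_id (0 : ℝ)).smul_const h).const_add ρ
  have h1 : HasDerivAt (fun t : ℝ => risk R Ψ (ρ + t • h)) (D h) 0 := by
    have hD' : HasFDerivAt (risk R Ψ) D (ρ + (0 : ℝ) • h) := by simpa using hD
    exact hD'.comp_hasDerivAt (0 : ℝ) hline
  have h2 : (fun t : ℝ => ∫ θ, g θ * (ρ + t • h : L1 d) θ)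
      = fun t : ℝ => (∫ θ, g θ * ρ θ) + t * ∫ θ, g θ * h θ := by
    funext t
    rw [← integral_const_mul, ← integral_add hρ (hh.const_mul t)]
    apply integral_congr_ae
    filter_upwards [Lp.coeFn_add ρ (t • h), Lp.coeFn_smul t h] with θ e1 e2
    simp only [e1, Pi.add_apply, e2, Pi.smul_apply, smul_eq_mul]
    ring
  have h3 : HasDerivAt (fun t : ℝ => ∫ θ, g θ * (ρ + t • h : L1 d) θ) (∫ θ, g θ * h θ) 0 := by
    rw [h2]
    simpa using ((hasDerivAt_id (0 : ℝ)).mul_const (∫ θ, g θ * h θ)).const_add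
      (∫ θ, g θ * ρ θ)
  have h4 : ∫ θ, regRiskDeriv R Ψ g ρ θ * h θ = D h + ∫ θ, g θ * h θ := by
    rw [hDh, ← integral_add hint hh]
    simp only [regRiskDeriv, add_mul]
  rw [h4]
  exact h1.add h3

end Functionals

end

end MeanField

/-! Fixed points of $T$ are the critical points of the free energy $F_0(\rho)+\beta^{-1}H(\rho)$,
where $H$ is the entropy relative to the weight $w=e^{-\beta g}$, which absorbs $g$. As $|F_0'|\le
M$ on the unit ball, every $T(\rho)$ lies in one band $aw\le\rho\le bw$ with $a,b>0$. There $H$ is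
finite, $L^1$-Lipschitz and strongly midpoint convex (`relEntropy_half_add_half_le`), so minimizing
sequences are Cauchy and a minimizer exists without any compactness argument.

With the potential frozen at $F_0'(\rho)$, the linearized free energy of any density in the band
exceeds that of $T(\rho)$ by their relative entropy (`relEntropy_sub_gibbs`). First-order optimality
at a minimizer $\rho$, tested against $T(\rho)$, makes this excess nonpositive, hence
$T(\rho)=\rho$. For two fixed points, the Gibbs inequality at one and monotonicity of $F_0'$ give
the reverse Gibbs inequality at the other, so they coincide. -/

namespace MeanField

/-! ### Convex minimization in normed spaces -/

section Variational

variable {X : Type*} [NormedAddCommGroup X] [NormedSpace ℝ X]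

/-- A function which is bounded below and strongly midpoint convex on a nonempty closed convex
subset of a Banach space attains its minimum. -/
theorem exists_isMinOn_of_strong_midpoint [CompleteSpace X] {K : Set X} (hK : IsClosed K)
    (hconv : Convex ℝ K) (hne : K.Nonempty) {J : X → ℝ} (hJ : ContinuousOn J K)
    (hbdd : BddBelow (J '' K)) {c : ℝ} (hc : 0 < c)
    (hmid : ∀ x ∈ K, ∀ y ∈ K,
      J ((1 / 2 : ℝ) • x + (1 / 2 : ℝ) • y) + c * ‖x - y‖ ^ 2 ≤ (J x + J y) / 2) :
    ∃ x ∈ K, IsMinOn J K x := by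
  set m := sInf (J '' K)
  have hm : ∀ x ∈ K, m ≤ J x := fun x hx => csInf_le hbdd ⟨x, hx, rfl⟩
  have hex : ∀ n : ℕ, ∃ x ∈ K, J x < m + 1 / ((n : ℝ) + 1) := by
    intro n
    obtain ⟨_, ⟨x, hx, rfl⟩, h⟩ := exists_lt_of_csInf_lt (hne.image J)
      (show m < m + 1 / ((n : ℝ) + 1) by linarith [Nat.one_div_pos_of_nat (α := ℝ) (n := n)])
    exact ⟨x, hx, h⟩
  choose u huK hu using hex
  -- The midpoint value is at least the infimum $m$, so $c\|u_n-u_k\|^2\le (J(u_n)+J(u_k))/2-m\le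
  -- 1/(N+1)$ for $n,k\ge N$.
  have hcauchy : CauchySeq u := by
    refine cauchySeq_of_le_tendsto_0 (fun N => √(1 / ((N : ℝ) + 1) * c⁻¹)) ?_ ?_
    · intro n k N hn hk
      rw [dist_eq_norm]
      apply Real.le_sqrt_of_sq_le
      rw [← div_eq_mul_inv, le_div_iff₀ hc]
      have h1 := hmid _ (huK n) _ (huK k)
      have h2 := hm _ (hconv (huK n) (huK k) (by norm_num : (0 : ℝ) ≤ 1 / 2)
        (by norm_num : (0 : ℝ) ≤ 1 / 2) (by norm_num))
      have h3 := Nat.one_div_le_one_div (α := ℝ) hn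
      have h4 := Nat.one_div_le_one_div (α := ℝ) hk
      linarith [hu n, hu k]
    · have := (tendsto_one_div_add_atTop_nhds_zero_nat (𝕜 := ℝ)).mul_const c⁻¹
      simpa [Function.comp_def] using (Real.continuous_sqrt.tendsto _).comp this
  obtain ⟨x, hx⟩ := cauchySeq_tendsto_of_complete hcauchy
  have hxK : x ∈ K := hK.mem_of_tendsto hx (Eventually.of_forall huK)
  refine ⟨x, hxK, fun y hy => le_trans ?_ (hm y hy)⟩
  have h1 : Tendsto (fun n => J (u n)) atTop (𝓝 (J x)) :=
    (hJ x hxK).tendsto.comp (tendsto_nhdsWithin_iff.2 ⟨hx, Eventually.of_forall huK⟩)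
  have h2 : Tendsto (fun n : ℕ => m + 1 / ((n : ℝ) + 1)) atTop (𝓝 m) := by
    simpa using (tendsto_one_div_add_atTop_nhds_zero_nat (𝕜 := ℝ)).const_add m
  exact le_of_tendsto_of_tendsto' h1 h2 fun n => (hu n).le

/-- First order optimality condition for the sum of a differentiable and a convex function. -/
theorem fderiv_add_sub_nonneg_of_isMinOn {K : Set X} {f φ : X → ℝ} {f' : X →L[ℝ] ℝ} {x y : X}
    (hf : HasFDerivAt f f' x) (hφ : ConvexOn ℝ K φ) (hx : x ∈ K) (hy : y ∈ K)
    (hmin : IsMinOn (fun z => f z + φ z) K x) : 0 ≤ f' (y - x) + (φ y - φ x) := by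
  have hd : HasDerivAt (fun t : ℝ => f (x + t • (y - x))) (f' (y - x)) 0 :=
    (hf.hasLineDerivAt (y - x))
  have hlim := hd.tendsto_slope_zero_right
  suffices φ x - φ y ≤ f' (y - x) by linarith
  refine ge_of_tendsto hlim ?_
  -- Minimality at $x+t(y-x)$, with convexity of `φ` along the segment, bounds the difference
  -- quotient of `f` from below.
  filter_upwards [Ioc_mem_nhdsGT (zero_lt_one' ℝ)] with t ht
  have hz : x + t • (y - x) = (1 - t) • x + t • y := by module
  have h1 : f x + φ x ≤ f (x + t • (y - x)) + φ (x + t • (y - x)) := by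
    rw [hz]
    exact hmin (hφ.1 hx hy (sub_nonneg.2 ht.2) ht.1.le (by ring))
  have h2 := hφ.2 hx hy (sub_nonneg.2 ht.2) ht.1.le (by ring)
  rw [← hz] at h2
  simp only [smul_eq_mul] at h2
  rw [smul_eq_mul, inv_mul_eq_div, le_div_iff₀ ht.1]
  simp only [zero_add, zero_smul, add_zero]
  nlinarith

/-- The gradient inequality for a differentiable convex function. -/
theorem fderiv_sub_le_of_convexOn {f : X → ℝ} (hf : ConvexOn ℝ Set.univ f)
    (hd : Differentiable ℝ f) (x y : X) : fderiv ℝ f x (y - x) ≤ f y - f x := by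
  -- The sum vanishes identically, so every point is a minimizer; `-f` plays the smooth part and `f`
  -- the convex part.
  have h : IsMinOn (fun z => -f z + f z) Set.univ x := fun z _ => by simp
  have := fderiv_add_sub_nonneg_of_isMinOn (hd x).hasFDerivAt.neg hf (Set.mem_univ x)
    (Set.mem_univ y) h
  simp only [neg_apply] at this
  linarith

/-- The derivative of a differentiable convex function is monotone. -/
theorem fderiv_sub_apply_nonneg_of_convexOn {f : X → ℝ} (hf : ConvexOn ℝ Set.univ f)
    (hd : Differentiable ℝ f) (x y : X) :
    0 ≤ (fderiv ℝ f x - fderiv ℝ f y) (x - y) := by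
  have h1 := fderiv_sub_le_of_convexOn hf hd x y
  have h2 := fderiv_sub_le_of_convexOn hf hd y x
  rw [← neg_sub x y, map_neg] at h1
  rw [sub_apply]
  linarith

end Variational

/-! ### Scalar inequalities for $x\log x$ -/

section Entropy

/-- Multiply $\log(t/s)\le t/s-1$ by $s$. Both the Lipschitz bound and Gibbs' inequality rest on
this. -/
theorem mul_log_tangent_le {s t : ℝ} (hs : 0 < s) (ht : 0 < t) :
    t * Real.log t + (Real.log t + 1) * (s - t) ≤ s * Real.log s := by
  have h := Real.log_le_sub_one_of_pos (div_pos ht hs)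
  rw [Real.log_div ht.ne' hs.ne'] at h
  have h2 := mul_le_mul_of_nonneg_left h hs.le
  have h3 : s * (t / s - 1) = t - s := by field_simp
  rw [h3] at h2
  linarith

theorem abs_log_le_of_mem_Icc {a b x : ℝ} (ha : 0 < a) (hx : x ∈ Set.Icc a b) :
    |Real.log x| ≤ |Real.log a| + |Real.log b| := by
  have h1 := Real.log_le_log ha hx.1
  have h2 := Real.log_le_log (ha.trans_le hx.1) hx.2
  rw [abs_le]
  constructor
  · linarith [neg_abs_le (Real.log a), abs_nonneg (Real.log b)]
  · linarith [le_abs_self (Real.log b), abs_nonneg (Real.log a)]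

theorem abs_mul_log_sub_le {a b s t : ℝ} (ha : 0 < a) (hs : s ∈ Set.Icc a b)
    (ht : t ∈ Set.Icc a b) :
    |s * Real.log s - t * Real.log t| ≤ (|Real.log a| + |Real.log b| + 1) * |s - t| := by
  have key : ∀ s ∈ Set.Icc a b, ∀ t ∈ Set.Icc a b,
      t * Real.log t - s * Real.log s ≤ (|Real.log a| + |Real.log b| + 1) * |s - t| := by
    intro s hs t ht
    have h := mul_log_tangent_le (ha.trans_le hs.1) (ha.trans_le ht.1)
    have h1 : |Real.log t + 1| ≤ |Real.log a| + |Real.log b| + 1 := by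
      refine (abs_add_le _ _).trans ?_
      rw [abs_one]
      linarith [abs_log_le_of_mem_Icc ha ht]
    have h2 : -((Real.log t + 1) * (s - t)) ≤ |Real.log t + 1| * |s - t| := by
      rw [← abs_mul]; exact neg_le_abs _
    have h3 := mul_le_mul_of_nonneg_right h1 (abs_nonneg (s - t))
    linarith
  rw [abs_le]
  constructor
  · linarith [key s hs t ht]
  · have := key t ht s hs
    rw [abs_sub_comm t s] at this
    linarith

/-- The second derivative $1/x-1/b$ is nonnegative on $(0,b)$. -/
theorem convexOn_mul_log_sub_sq {b : ℝ} (hb : 0 < b) :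
    ConvexOn ℝ (Set.Icc 0 b) fun x => x * Real.log x - x ^ 2 / (2 * b) := by
  refine convexOn_of_hasDerivWithinAt2_nonneg (convex_Icc 0 b)
    (f' := fun x => Real.log x + 1 - x / b) (f'' := fun x => x⁻¹ - 1 / b) ?_ ?_ ?_ ?_
  · exact (Real.continuous_mul_log.sub (by fun_prop)).continuousOn
  · intro x hx
    rw [interior_Icc] at hx
    refine ((Real.hasDerivAt_mul_log hx.1.ne').sub
      (((hasDerivAt_pow 2 x).div_const (2 * b)).congr_deriv ?_)).hasDerivWithinAt
    field_simp
    norm_num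
  · intro x hx
    rw [interior_Icc] at hx
    exact (((Real.hasDerivAt_log hx.1.ne').add_const 1).sub
      ((hasDerivAt_id x).div_const b)).hasDerivWithinAt
  · intro x hx
    rw [interior_Icc] at hx
    rw [one_div, sub_nonneg]
    exact inv_anti₀ hx.1 hx.2.le

/-- The subtracted quadratic $x^2/(2b)$ has midpoint gap exactly $(s-t)^2/(8b)$, which $x\log x$
inherits as a lower bound on its own gap. -/
theorem mul_log_half_add_half_le {b s t : ℝ} (hb : 0 < b) (hs : s ∈ Set.Icc 0 b)
    (ht : t ∈ Set.Icc 0 b) :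
    (1 / 2 * s + 1 / 2 * t) * Real.log (1 / 2 * s + 1 / 2 * t) + (s - t) ^ 2 / (8 * b)
      ≤ (s * Real.log s + t * Real.log t) / 2 := by
  have h := (convexOn_mul_log_sub_sq hb).2 hs ht (by norm_num : (0 : ℝ) ≤ 1 / 2)
    (by norm_num : (0 : ℝ) ≤ 1 / 2) (by norm_num)
  simp only [smul_eq_mul] at h
  have e : (s - t) ^ 2 / (8 * b) = 1 / 2 * (s ^ 2 / (2 * b)) + 1 / 2 * (t ^ 2 / (2 * b))
      - (1 / 2 * s + 1 / 2 * t) ^ 2 / (2 * b) := by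
    field_simp; ring
  linarith

/-- Gibbs' inequality, pointwise. -/
theorem mul_log_div_sub_nonneg {s t : ℝ} (hs : 0 < s) (ht : 0 < t) :
    0 ≤ s * Real.log (s / t) - s + t := by
  have h := mul_log_tangent_le hs ht
  rw [Real.log_div hs.ne' ht.ne']
  linarith

theorem eq_of_mul_log_div_sub_eq_zero {s t : ℝ} (hs : 0 < s) (ht : 0 < t)
    (h : s * Real.log (s / t) - s + t = 0) : s = t := by
  by_contra hne
  have hne' : t / s ≠ 1 := fun h' => hne ((div_eq_one_iff_eq hs.ne').1 h').symm
  have h1 := Real.log_lt_sub_one_of_pos (div_pos ht hs) hne'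
  have h2 := mul_lt_mul_of_pos_left h1 hs
  have h3 : s * (t / s - 1) = t - s := by field_simp
  rw [h3, Real.log_div ht.ne' hs.ne'] at h2
  rw [Real.log_div hs.ne' ht.ne'] at h
  linarith

end Entropy

/-! ### Relative entropy on a band of densities -/

section Band

variable {α : Type*} [MeasurableSpace α] {μ : Measure α} {w : α → ℝ} {a b : ℝ}

/-- The densities in `L¹` which lie between `a * w` and `b * w`. -/
def densityBand (μ : Measure α) (w : α → ℝ) (a b : ℝ) : Set (Lp ℝ 1 μ) :=
  {ρ | (∀ᵐ x ∂μ, ρ x ∈ Set.Icc (a * w x) (b * w x)) ∧ ∫ x, ρ x ∂μ = 1}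

/-- The entropy of `ρ` relative to the weight `w`. -/
noncomputable def relEntropy (w : α → ℝ) (ρ : Lp ℝ 1 μ) : ℝ :=
  ∫ x, ρ x * Real.log (ρ x / w x) ∂μ

theorem div_mem_Icc_of_mem_Icc_mul {r v : ℝ} (hv : 0 < v) (hr : r ∈ Set.Icc (a * v) (b * v)) :
    r / v ∈ Set.Icc a b :=
  ⟨(le_div_iff₀ hv).2 hr.1, (div_le_iff₀ hv).2 hr.2⟩

theorem isClosed_densityBand (hwi : Integrable w μ) : IsClosed (densityBand μ w a b) := by
  have e : densityBand μ w a b = Set.Icc ((hwi.const_mul a).toL1 _) ((hwi.const_mul b).toL1 _) ∩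
      {ρ : Lp ℝ 1 μ | ∫ x, ρ x ∂μ = 1} := by
    ext ρ
    have h1 := Integrable.coeFn_toL1 (hwi.const_mul a)
    have h2 := Integrable.coeFn_toL1 (hwi.const_mul b)
    simp only [densityBand, Set.mem_inter_iff, Set.mem_ofPred_eq, Set.mem_Icc, ← Lp.coeFn_le]
    refine and_congr_left fun _ => ⟨fun h => ⟨?_, ?_⟩, fun h => ?_⟩
    · filter_upwards [h, h1] with x hx e1
      exact e1.trans_le hx.1
    · filter_upwards [h, h2] with x hx e2
      exact hx.2.trans_eq e2.symm
    · filter_upwards [h.1, h.2, h1, h2] with x k1 k2 e1 e2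
      exact ⟨e1.symm.trans_le k1, k2.trans_eq e2⟩
  rw [e]
  exact isClosed_Icc.inter (isClosed_eq continuous_integral continuous_const)

theorem coeFn_smul_add_smul (p q : ℝ) (ρ σ : Lp ℝ 1 μ) :
    ((p • ρ + q • σ : Lp ℝ 1 μ) : α → ℝ) =ᵐ[μ] fun x => p * ρ x + q * σ x := by
  filter_upwards [Lp.coeFn_add (p • ρ) (q • σ), Lp.coeFn_smul p ρ, Lp.coeFn_smul q σ]
    with x h1 h2 h3
  rw [h1, Pi.add_apply, h2, h3]
  rfl

theorem convex_densityBand : Convex ℝ (densityBand μ w a b) := by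
  intro ρ hρ σ hσ p q hp hq hpq
  refine ⟨?_, ?_⟩
  · filter_upwards [coeFn_smul_add_smul p q ρ σ, hρ.1, hσ.1] with x e h1 h2
    rw [e]
    exact convex_Icc _ _ h1 h2 hp hq hpq
  · rw [integral_congr_ae (coeFn_smul_add_smul p q ρ σ),
      integral_add ((L1.integrable_coeFn ρ).const_mul p) ((L1.integrable_coeFn σ).const_mul q),
      integral_const_mul, integral_const_mul, hρ.2, hσ.2]
    linarith

theorem integrable_relEntropy (hw : ∀ x, 0 < w x) (hwi : Integrable w μ) (ha : 0 < a)
    {ρ : Lp ℝ 1 μ} (hρ : ρ ∈ densityBand μ w a b) :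
    Integrable (fun x => ρ x * Real.log (ρ x / w x)) μ := by
  refine (L1.integrable_coeFn ρ).mul_bdd (c := |Real.log a| + |Real.log b|) ?_ ?_
  · have h1 : AEMeasurable (fun x => ρ x) μ := (L1.integrable_coeFn ρ).aemeasurable
    exact (h1.div hwi.aemeasurable).log.aestronglyMeasurable
  · filter_upwards [hρ.1] with x hx
    exact abs_log_le_of_mem_Icc ha (div_mem_Icc_of_mem_Icc_mul (hw x) hx)

/-- Perspective form: inequalities for $x\log x$ at the ratio $r/v\in[a,b]$ transfer to densities
after multiplication by the weight. -/
theorem mul_log_div_eq {r v : ℝ} (hv : 0 < v) :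
    r * Real.log (r / v) = v * (r / v * Real.log (r / v)) := by
  field_simp

theorem convexOn_relEntropy (hw : ∀ x, 0 < w x) (hwi : Integrable w μ) (ha : 0 < a) :
    ConvexOn ℝ (densityBand μ w a b) (relEntropy w) := by
  refine ⟨convex_densityBand, fun ρ hρ σ hσ p q hp hq hpq => ?_⟩
  have hm := convex_densityBand hρ hσ hp hq hpq
  have iρ := integrable_relEntropy hw hwi ha hρ
  have iσ := integrable_relEntropy hw hwi ha hσ
  simp only [relEntropy, smul_eq_mul]
  rw [← integral_const_mul, ← integral_const_mul,
    ← integral_add (iρ.const_mul p) (iσ.const_mul q)]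
  refine integral_mono_ae (integrable_relEntropy hw hwi ha hm)
    ((iρ.const_mul p).add (iσ.const_mul q)) ?_
  filter_upwards [coeFn_smul_add_smul p q ρ σ, hρ.1, hσ.1] with x e h1 h2
  have k1 := div_mem_Icc_of_mem_Icc_mul (hw x) h1
  have k2 := div_mem_Icc_of_mem_Icc_mul (hw x) h2
  have h := Real.convexOn_mul_log.2 (ha.le.trans k1.1) (ha.le.trans k2.1) hp hq hpq
  simp only [smul_eq_mul] at h
  have e' : (p * ρ x + q * σ x) / w x = p * (ρ x / w x) + q * (σ x / w x) := by ring
  rw [e, mul_log_div_eq (hw x), mul_log_div_eq (r := ρ x) (hw x),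
    mul_log_div_eq (r := σ x) (hw x), e']
  have := mul_le_mul_of_nonneg_left h (hw x).le
  linarith

theorem norm_sub_eq_integral_abs (ρ σ : Lp ℝ 1 μ) : ‖ρ - σ‖ = ∫ x, |ρ x - σ x| ∂μ := by
  rw [L1.norm_eq_integral_norm]
  refine integral_congr_ae ?_
  filter_upwards [Lp.coeFn_sub ρ σ] with x h
  rw [h, Pi.sub_apply, Real.norm_eq_abs]

theorem integrable_abs_sub (ρ σ : Lp ℝ 1 μ) : Integrable (fun x => |ρ x - σ x|) μ :=
  ((L1.integrable_coeFn ρ).sub (L1.integrable_coeFn σ)).abs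

/-- The function $x\log x$ is Lipschitz on $[a,b]$, and the weight cancels:
$w\,|\rho/w-\sigma/w|=|\rho-\sigma|$. -/
theorem continuousOn_relEntropy (hw : ∀ x, 0 < w x) (hwi : Integrable w μ) (ha : 0 < a) :
    ContinuousOn (relEntropy w) (densityBand μ w a b) := by
  have hL : (0 : ℝ) ≤ |Real.log a| + |Real.log b| + 1 := by positivity
  refine LipschitzOnWith.continuousOn (K := Real.toNNReal (|Real.log a| + |Real.log b| + 1)) ?_
  refine LipschitzOnWith.of_dist_le_mul fun ρ hρ σ hσ => ?_
  have iρ := integrable_relEntropy hw hwi ha hρ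
  have iσ := integrable_relEntropy hw hwi ha hσ
  rw [dist_eq_norm, dist_eq_norm, norm_sub_eq_integral_abs, Real.coe_toNNReal _ hL,
    ← integral_const_mul, relEntropy, relEntropy, ← integral_sub iρ iσ]
  refine norm_integral_le_of_norm_le ((integrable_abs_sub ρ σ).const_mul _) ?_
  filter_upwards [hρ.1, hσ.1] with x h1 h2
  have h := abs_mul_log_sub_le ha (div_mem_Icc_of_mem_Icc_mul (hw x) h1)
    (div_mem_Icc_of_mem_Icc_mul (hw x) h2)
  rw [mul_log_div_eq (r := ρ x) (hw x), mul_log_div_eq (r := σ x) (hw x), ← mul_sub,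
    Real.norm_eq_abs, abs_mul, abs_of_pos (hw x)]
  refine (mul_le_mul_of_nonneg_left h (hw x).le).trans_eq ?_
  rw [← sub_div, abs_div, abs_of_pos (hw x)]
  field_simp [(hw x).ne']

theorem bddBelow_relEntropy (hw : ∀ x, 0 < w x) (hwi : Integrable w μ) (ha : 0 < a) :
    BddBelow (relEntropy w '' densityBand μ w a b) := by
  refine ⟨1 - ∫ x, w x ∂μ, ?_⟩
  rintro _ ⟨ρ, hρ, rfl⟩
  rw [← hρ.2, relEntropy, ← integral_sub (L1.integrable_coeFn ρ) hwi]
  refine integral_mono_ae ((L1.integrable_coeFn ρ).sub hwi)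
    (integrable_relEntropy hw hwi ha hρ) ?_
  filter_upwards [hρ.1] with x hx
  have := mul_log_div_sub_nonneg ((mul_pos ha (hw x)).trans_le hx.1) (hw x)
  linarith

/-- The pointwise gain is $(\rho-\sigma)^2/(8bw)$; by Cauchy–Schwarz its integral controls the
squared $L^1$ distance. -/
theorem relEntropy_half_add_half_le (hw : ∀ x, 0 < w x) (hwi : Integrable w μ)
    (hW : 0 < ∫ x, w x ∂μ) (ha : 0 < a) (hb : 0 < b) {ρ σ : Lp ℝ 1 μ}
    (hρ : ρ ∈ densityBand μ w a b) (hσ : σ ∈ densityBand μ w a b) :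
    relEntropy w ((1 / 2 : ℝ) • ρ + (1 / 2 : ℝ) • σ)
        + 1 / (8 * b * ∫ x, w x ∂μ) * ‖ρ - σ‖ ^ 2
      ≤ (relEntropy w ρ + relEntropy w σ) / 2 := by
  have hm := convex_densityBand hρ hσ (by norm_num : (0 : ℝ) ≤ 1 / 2)
    (by norm_num : (0 : ℝ) ≤ 1 / 2) (by norm_num)
  have im := integrable_relEntropy hw hwi ha hm
  have iρ := integrable_relEntropy hw hwi ha hρ
  have iσ := integrable_relEntropy hw hwi ha hσ
  have iD := integrable_abs_sub ρ σ
  rw [norm_sub_eq_integral_abs]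
  set W := ∫ x, w x ∂μ
  set D := ∫ x, |ρ x - σ x| ∂μ with hD
  -- Cauchy–Schwarz in linearized form: expand $(|\rho-\sigma|-lw)^2\ge 0$ and divide by $w$. The
  -- choice $l=D/W$ maximizes the integrated bound $2lD-l^2W$.
  set l := D / W
  have key : ∀ᵐ x ∂μ,
      ((1 / 2 : ℝ) • ρ + (1 / 2 : ℝ) • σ : Lp ℝ 1 μ) x *
          Real.log (((1 / 2 : ℝ) • ρ + (1 / 2 : ℝ) • σ : Lp ℝ 1 μ) x / w x)
        + (2 * l / (8 * b) * |ρ x - σ x| - l ^ 2 / (8 * b) * w x)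
      ≤ 1 / 2 * (ρ x * Real.log (ρ x / w x)) + 1 / 2 * (σ x * Real.log (σ x / w x)) := by
    filter_upwards [coeFn_smul_add_smul (1 / 2) (1 / 2) ρ σ, hρ.1, hσ.1] with x e h1 h2
    have hwx := hw x
    have k1 := div_mem_Icc_of_mem_Icc_mul hwx h1
    have k2 := div_mem_Icc_of_mem_Icc_mul hwx h2
    have h := mul_log_half_add_half_le hb ⟨ha.le.trans k1.1, k1.2⟩ ⟨ha.le.trans k2.1, k2.2⟩
    have e' : (1 / 2 * ρ x + 1 / 2 * σ x) / w x
        = 1 / 2 * (ρ x / w x) + 1 / 2 * (σ x / w x) := by ring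
    rw [e, mul_log_div_eq hwx, mul_log_div_eq (r := ρ x) hwx, mul_log_div_eq (r := σ x) hwx, e']
    have h' := mul_le_mul_of_nonneg_left h hwx.le
    have hsq : 2 * l / (8 * b) * |ρ x - σ x| - l ^ 2 / (8 * b) * w x
        ≤ w x * ((ρ x / w x - σ x / w x) ^ 2 / (8 * b)) := by
      have e1 : w x * ((ρ x / w x - σ x / w x) ^ 2 / (8 * b))
          - (2 * l / (8 * b) * |ρ x - σ x| - l ^ 2 / (8 * b) * w x)
          = (|ρ x - σ x| - l * w x) ^ 2 / (8 * b * w x) := by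
        have e2 : (ρ x / w x - σ x / w x) ^ 2 = |ρ x - σ x| ^ 2 / w x ^ 2 := by
          rw [← sub_div, div_pow, sq_abs]
        rw [e2]
        field_simp
        ring
      have e3 : 0 ≤ (|ρ x - σ x| - l * w x) ^ 2 / (8 * b * w x) := by positivity
      linarith
    linarith
  have iE : Integrable (fun x => 2 * l / (8 * b) * |ρ x - σ x| - l ^ 2 / (8 * b) * w x) μ :=
    (iD.const_mul _).sub (hwi.const_mul _)
  have hbound := integral_mono_ae (im.add iE)
    ((iρ.const_mul (1 / 2)).add (iσ.const_mul (1 / 2))) key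
  simp only [Pi.add_apply] at hbound
  rw [integral_add im iE,
    integral_sub (iD.const_mul _) (hwi.const_mul _),
    integral_add (iρ.const_mul _) (iσ.const_mul _), integral_const_mul, integral_const_mul,
    integral_const_mul, integral_const_mul, ← hD] at hbound
  have e4 : 2 * l / (8 * b) * D - l ^ 2 / (8 * b) * W = 1 / (8 * b * W) * D ^ 2 := by
    simp only [l]
    field_simp
    ring
  change relEntropy w _ + (2 * l / (8 * b) * D - l ^ 2 / (8 * b) * W)
    ≤ 1 / 2 * relEntropy w ρ + 1 / 2 * relEntropy w σ at hbound
  rw [e4] at hbound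
  linarith

/-- A continuous convex functional that is bounded below has a minimizer in the band after
adding a positive multiple of the relative entropy. -/
theorem exists_isMinOn_add_relEntropy (hw : ∀ x, 0 < w x) (hwi : Integrable w μ)
    (hW : 0 < ∫ x, w x ∂μ) (ha : 0 < a) (hb : 0 < b) (hne : (densityBand μ w a b).Nonempty)
    {f : Lp ℝ 1 μ → ℝ} (hf : Continuous f) (hconv : ConvexOn ℝ Set.univ f)
    (hf0 : ∀ ρ, 0 ≤ f ρ) {κ : ℝ} (hκ : 0 < κ) :
    ∃ ρ ∈ densityBand μ w a b,
      IsMinOn (fun ρ => f ρ + κ * relEntropy w ρ) (densityBand μ w a b) ρ := by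
  obtain ⟨m, hm⟩ := bddBelow_relEntropy (b := b) hw hwi ha
  refine exists_isMinOn_of_strong_midpoint (isClosed_densityBand hwi) convex_densityBand hne
    (hf.continuousOn.add (continuousOn_const.mul (continuousOn_relEntropy hw hwi ha)))
    ⟨κ * m, ?_⟩ (c := κ * (1 / (8 * b * ∫ x, w x ∂μ))) (by positivity) ?_
  · rintro _ ⟨ρ, hρ, rfl⟩
    have h1 := mul_le_mul_of_nonneg_left (hm ⟨ρ, hρ, rfl⟩) hκ.le
    have h2 := hf0 ρ
    linarith
  · intro ρ hρ σ hσ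
    have h1 := mul_le_mul_of_nonneg_left
      (relEntropy_half_add_half_le hw hwi hW ha hb hρ hσ) hκ.le
    have h2 := hconv.2 (Set.mem_univ ρ) (Set.mem_univ σ) (by norm_num : (0 : ℝ) ≤ 1 / 2)
      (by norm_num : (0 : ℝ) ≤ 1 / 2) (by norm_num)
    simp only [smul_eq_mul] at h2
    linarith

end Band

/-! ### Gibbs densities and their variational principle -/

section Gibbs

variable {α : Type*} [MeasurableSpace α] {μ : Measure α} {w f : α → ℝ} {a b β M : ℝ}

theorem exp_neg_mul_mem_Icc (hβ : 0 < β) {t : ℝ} (ht : |t| ≤ M) :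
    Real.exp (-β * t) ∈ Set.Icc (Real.exp (-(β * M))) (Real.exp (β * M)) := by
  obtain ⟨h1, h2⟩ := abs_le.1 ht
  constructor <;> apply Real.exp_le_exp.2 <;> nlinarith

theorem integrable_exp_neg_mul (hwi : Integrable w μ) (hβ : 0 < β)
    (hfm : AEMeasurable f μ) (hf : ∀ x, |f x| ≤ M) :
    Integrable (fun x => Real.exp (-β * f x) * w x) μ := by
  refine hwi.bdd_mul (c := Real.exp (β * M))
    (hfm.const_mul (-β)).exp.aestronglyMeasurable (Eventually.of_forall fun x => ?_)
  rw [Real.norm_eq_abs, Real.abs_exp]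
  exact (exp_neg_mul_mem_Icc hβ (hf x)).2

theorem integral_exp_neg_mul_mem_Icc (hw : ∀ x, 0 < w x) (hwi : Integrable w μ) (hβ : 0 < β)
    (hfm : AEMeasurable f μ) (hf : ∀ x, |f x| ≤ M) :
    ∫ x, Real.exp (-β * f x) * w x ∂μ ∈ Set.Icc (Real.exp (-(β * M)) * ∫ x, w x ∂μ)
      (Real.exp (β * M) * ∫ x, w x ∂μ) := by
  have hi := integrable_exp_neg_mul hwi hβ hfm hf
  rw [← integral_const_mul, ← integral_const_mul]
  exact ⟨integral_mono (hwi.const_mul _) hi fun x =>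
      mul_le_mul_of_nonneg_right (exp_neg_mul_mem_Icc hβ (hf x)).1 (hw x).le,
    integral_mono hi (hwi.const_mul _) fun x =>
      mul_le_mul_of_nonneg_right (exp_neg_mul_mem_Icc hβ (hf x)).2 (hw x).le⟩

/-- Gibbs densities of bounded potentials lie in a band that depends on the bound only. -/
theorem gibbs_mem_densityBand (hw : ∀ x, 0 < w x) (hwi : Integrable w μ)
    (hW : 0 < ∫ x, w x ∂μ) (hβ : 0 < β) (hfm : AEMeasurable f μ) (hf : ∀ x, |f x| ≤ M)
    {σ : Lp ℝ 1 μ} (hσ : σ =ᵐ[μ] fun x =>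
      Real.exp (-β * f x) * w x / ∫ x, Real.exp (-β * f x) * w x ∂μ) :
    σ ∈ densityBand μ w (Real.exp (-(β * M)) / (Real.exp (β * M) * ∫ x, w x ∂μ))
      (Real.exp (β * M) / (Real.exp (-(β * M)) * ∫ x, w x ∂μ)) := by
  -- The band constants are the least numerator over the greatest normalizer, and the reverse.
  obtain ⟨h1, h2⟩ := integral_exp_neg_mul_mem_Icc hw hwi hβ hfm hf
  have hZ : 0 < ∫ x, Real.exp (-β * f x) * w x ∂μ := lt_of_lt_of_le (by positivity) h1
  refine ⟨?_, ?_⟩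
  · filter_upwards [hσ] with x hx
    obtain ⟨k1, k2⟩ := exp_neg_mul_mem_Icc hβ (hf x)
    have hwx := hw x
    rw [hx, div_mul_eq_mul_div, div_mul_eq_mul_div]
    exact ⟨by gcongr, by gcongr⟩
  · rw [integral_congr_ae hσ, integral_div, div_self hZ.ne']

/-- The free energy of `ρ` exceeds the one of the Gibbs density `σ` by their relative entropy. -/
theorem relEntropy_sub_gibbs (hw : ∀ x, 0 < w x) (hwi : Integrable w μ) (ha : 0 < a)
    {ρ σ : Lp ℝ 1 μ} (hρ : ρ ∈ densityBand μ w a b) (hσ : σ ∈ densityBand μ w a b)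
    (hfρ : Integrable (fun x => f x * ρ x) μ) (hfσ : Integrable (fun x => f x * σ x) μ)
    {Z : ℝ} (hZ : 0 < Z) (hgibbs : σ =ᵐ[μ] fun x => Real.exp (-β * f x) * w x / Z) :
    Integrable (fun x => ρ x * Real.log (ρ x / σ x) - ρ x + σ x) μ ∧
    ∫ x, (ρ x * Real.log (ρ x / σ x) - ρ x + σ x) ∂μ =
      (relEntropy w ρ + β * ∫ x, f x * ρ x ∂μ) - (relEntropy w σ + β * ∫ x, f x * σ x ∂μ) := by
  have iρ := integrable_relEntropy hw hwi ha hρ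
  have jρ := L1.integrable_coeFn ρ
  have jσ := L1.integrable_coeFn σ
  have hlog : ∀ᵐ x ∂μ, Real.log (σ x / w x) = -β * f x - Real.log Z := by
    filter_upwards [hgibbs] with x hx
    have hwx := (hw x).ne'
    have e : σ x / w x = Real.exp (-β * f x) / Z := by
      rw [hx]; field_simp
    rw [e, Real.log_div (Real.exp_ne_zero _) hZ.ne', Real.log_exp]
  have e1 : relEntropy w σ = -β * ∫ x, f x * σ x ∂μ - Real.log Z := by
    have : relEntropy w σ = ∫ x, (-β * (f x * σ x) - Real.log Z * σ x) ∂μ := by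
      refine integral_congr_ae ?_
      filter_upwards [hlog] with x hx
      rw [hx]; ring
    rw [this, integral_sub (hfσ.const_mul _) (jσ.const_mul _), integral_const_mul,
      integral_const_mul, hσ.2, mul_one]
  -- The terms $-\rho+\sigma$ integrate to zero since both masses are one; they make the integrand
  -- pointwise nonnegative.
  have e2 : (fun x => ρ x * Real.log (ρ x / σ x) - ρ x + σ x) =ᵐ[μ]
      fun x => ρ x * Real.log (ρ x / w x) + β * (f x * ρ x) + (Real.log Z - 1) * ρ x + σ x := by
    filter_upwards [hlog, hρ.1, hσ.1] with x hx h1 h2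
    have p1 : 0 < ρ x := (mul_pos ha (hw x)).trans_le h1.1
    have p2 : 0 < σ x := (mul_pos ha (hw x)).trans_le h2.1
    rw [Real.log_div p2.ne' (hw x).ne'] at hx
    rw [Real.log_div p1.ne' p2.ne', Real.log_div p1.ne' (hw x).ne',
      show Real.log (σ x) = -β * f x - Real.log Z + Real.log (w x) by linarith]
    ring
  have i1 : Integrable (fun x => ρ x * Real.log (ρ x / w x) + β * (f x * ρ x)) μ :=
    iρ.add (hfρ.const_mul _)
  have i2 : Integrable (fun x => ρ x * Real.log (ρ x / w x) + β * (f x * ρ x)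
      + (Real.log Z - 1) * ρ x) μ := i1.add (jρ.const_mul _)
  refine ⟨(i2.add jσ).congr e2.symm, ?_⟩
  rw [integral_congr_ae e2, integral_add i2 jσ, integral_add i1 (jρ.const_mul _),
    integral_add iρ (hfρ.const_mul _), integral_const_mul, integral_const_mul, hρ.2, hσ.2, e1,
    relEntropy]
  ring

/-- Gibbs variational principle: the Gibbs density minimizes the free energy. -/
theorem gibbs_freeEnergy_le (hw : ∀ x, 0 < w x) (hwi : Integrable w μ) (ha : 0 < a)
    {ρ σ : Lp ℝ 1 μ} (hρ : ρ ∈ densityBand μ w a b) (hσ : σ ∈ densityBand μ w a b)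
    (hfρ : Integrable (fun x => f x * ρ x) μ) (hfσ : Integrable (fun x => f x * σ x) μ)
    {Z : ℝ} (hZ : 0 < Z) (hgibbs : σ =ᵐ[μ] fun x => Real.exp (-β * f x) * w x / Z) :
    relEntropy w σ + β * ∫ x, f x * σ x ∂μ ≤ relEntropy w ρ + β * ∫ x, f x * ρ x ∂μ := by
  rw [← sub_nonneg, ← (relEntropy_sub_gibbs hw hwi ha hρ hσ hfρ hfσ hZ hgibbs).2]
  refine integral_nonneg_of_ae ?_
  filter_upwards [hρ.1, hσ.1] with x h1 h2
  exact mul_log_div_sub_nonneg ((mul_pos ha (hw x)).trans_le h1.1)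
    ((mul_pos ha (hw x)).trans_le h2.1)

/-- The Gibbs density is the only minimizer of the free energy. -/
theorem eq_gibbs_of_freeEnergy_le (hw : ∀ x, 0 < w x) (hwi : Integrable w μ) (ha : 0 < a)
    {ρ σ : Lp ℝ 1 μ} (hρ : ρ ∈ densityBand μ w a b) (hσ : σ ∈ densityBand μ w a b)
    (hfρ : Integrable (fun x => f x * ρ x) μ) (hfσ : Integrable (fun x => f x * σ x) μ)
    {Z : ℝ} (hZ : 0 < Z) (hgibbs : σ =ᵐ[μ] fun x => Real.exp (-β * f x) * w x / Z)
    (hle : relEntropy w ρ + β * ∫ x, f x * ρ x ∂μ ≤ relEntropy w σ + β * ∫ x, f x * σ x ∂μ) :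
    ρ = σ := by
  obtain ⟨hi, he⟩ := relEntropy_sub_gibbs hw hwi ha hρ hσ hfρ hfσ hZ hgibbs
  have hpos : ∀ᵐ x ∂μ, 0 < ρ x ∧ 0 < σ x := by
    filter_upwards [hρ.1, hσ.1] with x h1 h2
    exact ⟨(mul_pos ha (hw x)).trans_le h1.1, (mul_pos ha (hw x)).trans_le h2.1⟩
  have hnn : 0 ≤ᵐ[μ] fun x => ρ x * Real.log (ρ x / σ x) - ρ x + σ x := by
    filter_upwards [hpos] with x h
    exact mul_log_div_sub_nonneg h.1 h.2
  have h0 := (integral_eq_zero_iff_of_nonneg_ae hnn hi).1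
    (le_antisymm (by linarith) (integral_nonneg_of_ae hnn))
  apply Lp.ext
  filter_upwards [hpos, h0] with x h hx
  exact eq_of_mul_log_div_sub_eq_zero h.1 h.2 hx

end Gibbs

/-! ### The Boltzmann map and the fixed point -/

section FixedPoint

variable {d : ℕ} {E : Type*} [NormedAddCommGroup E] [InnerProductSpace ℝ E] {R : E → ℝ}
  {Ψ : Param d → E} {g : Param d → ℝ} {β : ℝ}

theorem norm_eq_one_of_mem_densities {ρ : L1 d} (hρ : ρ ∈ densities d) : ‖ρ‖ = 1 := by
  rw [L1.norm_eq_integral_norm, ← hρ.2]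
  refine integral_congr_ae ?_
  filter_upwards [hρ.1] with θ h
  exact abs_of_nonneg h

theorem densityBand_subset_densities {w : Param d → ℝ} (hw : ∀ θ, 0 < w θ) {a b : ℝ}
    (ha : 0 < a) : densityBand volume w a b ⊆ densities d := by
  refine fun ρ hρ => ⟨?_, hρ.2⟩
  filter_upwards [hρ.1] with θ h
  exact (mul_pos ha (hw θ)).le.trans h.1

/-- This supplies the measurability of the Boltzmann weight. -/
theorem continuous_riskDeriv
    (h : Set.UniformEquicontinuous
      {f : Param d → ℝ | ∃ ρ : L1 d, ‖ρ‖ ≤ 1 ∧ f = riskDeriv R Ψ ρ})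
    {ρ : L1 d} (hρ : ‖ρ‖ ≤ 1) : Continuous (riskDeriv R Ψ ρ) :=
  (UniformEquicontinuous.uniformContinuous h ⟨riskDeriv R Ψ ρ, ρ, hρ, rfl⟩).continuous

/-- The unbounded term $g$ passes into the reference weight, leaving a bounded potential. -/
theorem boltzmannWeight_eq (ρ : L1 d) (θ : Param d) :
    boltzmannWeight R Ψ g β ρ θ
      = Real.exp (-β * riskDeriv R Ψ ρ θ) * Real.exp (-β * g θ) := by
  rw [boltzmannWeight, regRiskDeriv, mul_add, Real.exp_add]

theorem integrable_riskDeriv_mul (hΨ : PairingDefined Ψ) (ρ h : L1 d) :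
    Integrable (fun θ => riskDeriv R Ψ ρ θ * h θ) := by
  have := (fderiv ℝ R (pairing Ψ ρ)).integrable_comp (hΨ h)
  simpa [riskDeriv, mul_comm] using this

theorem integral_riskDeriv_mul [CompleteSpace E] (hΨ : PairingDefined Ψ) (ρ h : L1 d) :
    ∫ θ, riskDeriv R Ψ ρ θ * h θ = fderiv ℝ R (pairing Ψ ρ) (pairing Ψ h) := by
  change _ = fderiv ℝ R (pairing Ψ ρ) (∫ θ, h θ • Ψ θ)
  rw [← ContinuousLinearMap.integral_comp_comm _ (hΨ h)]
  simp [riskDeriv, mul_comm]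

theorem convexOn_risk (hR : ConvexOn ℝ Set.univ R) (hΨ : PairingDefined Ψ) :
    ConvexOn ℝ Set.univ (risk R Ψ) :=
  hR.comp_linearMap (pairingLin hΨ)

/-- This is monotonicity of $R'$ at the two pairings, expanded into the four integrals that the
Gibbs inequalities compare. -/
theorem integral_riskDeriv_sub_mul_sub_nonneg [CompleteSpace E] (hR : ConvexOn ℝ Set.univ R)
    (hd : Differentiable ℝ R) (hΨ : PairingDefined Ψ) (ρ σ : L1 d) :
    0 ≤ (∫ θ, riskDeriv R Ψ ρ θ * ρ θ) - (∫ θ, riskDeriv R Ψ ρ θ * σ θ)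
      - ((∫ θ, riskDeriv R Ψ σ θ * ρ θ) - ∫ θ, riskDeriv R Ψ σ θ * σ θ) := by
  have h := fderiv_sub_apply_nonneg_of_convexOn hR hd (pairing Ψ ρ) (pairing Ψ σ)
  simp only [integral_riskDeriv_mul hΨ]
  simp only [sub_apply, map_sub] at h
  linarith

end FixedPoint

end MeanField

theorem proposition2 {d : ℕ} {E : Type*} [NormedAddCommGroup E] [InnerProductSpace ℝ E]
    [CompleteSpace E]
    -- the risk functional is nonnegative, convex and Fréchet differentiable
    (R : E → ℝ) (hR_nonneg : ∀ x, 0 ≤ R x) (hR_convex : ConvexOn ℝ Set.univ R)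
    (hR_diff : Differentiable ℝ R)
    -- the feature map, for which `F₀` is defined on `L¹`
    (Ψ : MeanField.Param d → E) (hΨ : MeanField.PairingDefined Ψ)
    -- the differentials of `F₀` on the unit ball of `L¹`
    (h_equicont : Set.UniformEquicontinuous
      {f : MeanField.Param d → ℝ | ∃ ρ : MeanField.L1 d, ‖ρ‖ ≤ 1 ∧
        f = MeanField.riskDeriv R Ψ ρ})
    (h_bdd : ∃ M : ℝ, ∀ ρ : MeanField.L1 d, ‖ρ‖ ≤ 1 →
      ∀ θ, |MeanField.riskDeriv R Ψ ρ θ| ≤ M)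
    -- the regularizer
    (g : MeanField.Param d → ℝ) (hg_nonneg : ∀ θ, 0 ≤ g θ) (hg_diff : Differentiable ℝ g)
    (hg_conf : MeanField.IsConfining g)
    (β : ℝ) (hβ : 0 < β) :
    (∀ ρ ∈ MeanField.densities d,
      Integrable (MeanField.boltzmannWeight R Ψ g β ρ) ∧
        0 < MeanField.partitionFn R Ψ g β ρ) ∧
    ∃ T : MeanField.densities d → MeanField.densities d,
      (∀ ρ : MeanField.densities d,
        ((T ρ : MeanField.L1 d) : MeanField.Param d → ℝ) =ᵐ[volume]
          fun θ => MeanField.boltzmannWeight R Ψ g β ρ θ / MeanField.partitionFn R Ψ g β ρ) ∧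
      ∃! ρ : MeanField.densities d, Function.IsFixedPt T ρ := by
  open MeanField in
  obtain ⟨M, hM⟩ := h_bdd
  set w : Param d → ℝ := fun θ => Real.exp (-β * g θ) with hw_def
  have hw : ∀ θ, 0 < w θ := fun θ => Real.exp_pos _
  have hwi : Integrable w := hg_conf.2 β hβ
  have hW : 0 < ∫ θ, w θ := integral_exp_pos hwi
  have hfm : ∀ ρ : L1 d, ‖ρ‖ ≤ 1 → AEMeasurable (riskDeriv R Ψ ρ) := fun ρ hρ =>
    (continuous_riskDeriv h_equicont hρ).aemeasurable
  have hweight : ∀ ρ : L1 d, boltzmannWeight R Ψ g β ρ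
      = fun θ => Real.exp (-β * riskDeriv R Ψ ρ θ) * w θ :=
    fun ρ => funext (boltzmannWeight_eq ρ)
  have hpart : ∀ ρ : L1 d, partitionFn R Ψ g β ρ
      = ∫ θ, Real.exp (-β * riskDeriv R Ψ ρ θ) * w θ := fun ρ => by
    rw [partitionFn, hweight]
  have hbound : ∀ ρ : L1 d, ‖ρ‖ ≤ 1 → Integrable (boltzmannWeight R Ψ g β ρ) := fun ρ hρ => by
    rw [hweight]
    exact integrable_exp_neg_mul hwi hβ (hfm ρ hρ) (hM ρ hρ)
  have hZ : ∀ ρ : L1 d, ‖ρ‖ ≤ 1 → 0 < partitionFn R Ψ g β ρ := fun ρ hρ =>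
    integral_exp_pos (hbound ρ hρ)
  have hnorm : ∀ ρ ∈ densities d, ‖ρ‖ ≤ 1 := fun ρ hρ => (norm_eq_one_of_mem_densities hρ).le
  refine ⟨fun ρ hρ => ⟨hbound ρ (hnorm ρ hρ), hZ ρ (hnorm ρ hρ)⟩, ?_⟩
  -- Since `M` serves the whole unit ball, a single band contains $T(\rho)$ for every density
  -- $\rho$.
  set a := Real.exp (-(β * M)) / (Real.exp (β * M) * ∫ θ, w θ)
  set b := Real.exp (β * M) / (Real.exp (-(β * M)) * ∫ θ, w θ)
  have ha : 0 < a := by positivity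
  have hb : 0 < b := by positivity
  have hgibbs : ∀ ρ : L1 d, ‖ρ‖ ≤ 1 → ∃ σ ∈ densityBand volume w a b,
      σ =ᵐ[volume] fun θ => boltzmannWeight R Ψ g β ρ θ / partitionFn R Ψ g β ρ := by
    intro ρ hρ
    have h := Integrable.coeFn_toL1 ((hbound ρ hρ).div_const (partitionFn R Ψ g β ρ))
    refine ⟨_, gibbs_mem_densityBand hw hwi hW hβ (hfm ρ hρ) (hM ρ hρ) ?_, h⟩
    simpa only [hweight, hpart] using h
  have hsub : densityBand volume w a b ⊆ densities d := densityBand_subset_densities hw ha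
  choose S hSband hS using fun ρ : densities d => hgibbs ρ (hnorm ρ ρ.2)
  have hS' : ∀ ρ : densities d, S ρ =ᵐ[volume] fun θ =>
      Real.exp (-β * riskDeriv R Ψ ρ θ) * w θ / partitionFn R Ψ g β ρ := fun ρ => by
    simpa only [hweight] using hS ρ
  have hi := fun ρ σ : L1 d => integrable_riskDeriv_mul (R := R) hΨ ρ σ
  refine ⟨fun ρ => ⟨S ρ, hsub (hSband ρ)⟩, hS, ?_⟩
  refine existsUnique_of_exists_of_unique ?_ ?_
  -- The zero class is no density, but it lies in the unit ball, so its Gibbs density shows that the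
  -- band is nonempty.
  · obtain ⟨σ₀, hσ₀, -⟩ := hgibbs 0 (by simp)
    obtain ⟨ρ, hρ, hmin⟩ := exists_isMinOn_add_relEntropy hw hwi hW ha hb ⟨σ₀, hσ₀⟩
      (f := risk R Ψ) (hR_diff.continuous.comp (continuous_pairing hΨ))
      (convexOn_risk hR_convex hΨ) (fun ρ => hR_nonneg _) (inv_pos.2 hβ)
    refine ⟨⟨ρ, hsub hρ⟩, Subtype.ext ?_⟩
    set ρ' : densities d := ⟨ρ, hsub hρ⟩
    obtain ⟨D, hD, hDh⟩ := hasFDerivAt_risk hR_diff hΨ ρ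
    -- The competitor `S ρ'` is admissible because $T$ maps into the band.
    have hopt := fderiv_add_sub_nonneg_of_isMinOn hD
      ((convexOn_relEntropy hw hwi ha).smul (inv_pos.2 hβ).le) hρ (hSband ρ') hmin
    rw [map_sub, hDh, hDh] at hopt
    simp only [smul_eq_mul] at hopt
    refine (eq_gibbs_of_freeEnergy_le hw hwi ha hρ (hSband ρ') (hi ρ ρ) (hi ρ (S ρ'))
      (hZ ρ (hnorm ρ ρ'.2)) (hS' ρ') ?_).symm
    have h := mul_nonneg hβ.le hopt
    have e : β * β⁻¹ = 1 := mul_inv_cancel₀ hβ.ne'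
    linear_combination h + (relEntropy w (S ρ') - relEntropy w ρ) * e
  · intro ρ σ hρ hσ
    have eρ : S ρ = ρ := congrArg Subtype.val hρ
    have eσ : S σ = σ := congrArg Subtype.val hσ
    have bρ := eρ ▸ hSband ρ
    have bσ := eσ ▸ hSband σ
    have gρ := hS' ρ
    have gσ := hS' σ
    rw [eρ] at gρ
    rw [eσ] at gσ
    -- Here the potential is frozen at `ρ`. Adding $\beta$ times monotonicity replaces it by the
    -- potential at `σ`, for which `σ` is the only minimizer.
    have h1 := gibbs_freeEnergy_le hw hwi ha bσ bρ (hi ρ σ) (hi ρ ρ) (hZ ρ (hnorm ρ ρ.2)) gρ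
    have h2 := mul_nonneg hβ.le
      (integral_riskDeriv_sub_mul_sub_nonneg hR_convex hR_diff hΨ (ρ : L1 d) σ)
    refine Subtype.ext (eq_gibbs_of_freeEnergy_le hw hwi ha bρ bσ (hi σ ρ) (hi σ σ)
      (hZ σ (hnorm σ σ.2)) gσ ?_)
    linarith
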